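/- Let $R$ be a commutative ring with unity which is not arithmetic, i.e. for some maximal ideal $Q$ of $R$ the ideals of the localization $R_Q$ are not totally ordered by inclusion. Then there exists a pure-injective $R$-module which is not RD-injective. More precisely, there exist a maximal ideal $P$ of $R$ and two elements $a,b\in P$ such that, $E_R(R/P)$ denoting the injective hull of the $R$-module $R/P$, the module $$S=\{x\in E_R(R/P)\mid ax=0 \text{ and } bx=0\}$$ is pure-injective but not RD-injective. Here a short exact sequence $0\to N\to M\to L\to 0$ of $R$-modules is pure-exact if it remains exact after tensoring with any $R$-module, and RD-exact if $rM\cap N=rN$ for every $r\in R$ (viewing $N$ as a submodule of $M$). An $R$-module $F$ is pure-injective (respectively RD-injective) if for every pure-exact (respectively RD-exact) sequence $0\to N\to M\to L\to 0$ the sequence $0\to \mathrm{Hom}_R(L,F)\to \mathrm{Hom}_R(M,F)\to \mathrm{Hom}_R(N,F)\to 0$ is exact. -/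

import Mathlib

open scoped Pointwise TensorProduct

universe u

/-- A module is uniserial if its submodules are totally ordered by inclusion. -/
def IsUniserial (A M : Type u) [CommRing A] [AddCommGroup M] [Module A M] : Prop :=
  ∀ N N' : Submodule A M, N ≤ N' ∨ N' ≤ N

/-- A commutative ring (possibly with zero divisors) is a valuation ring if it is uniserial as a
module over itself. -/
def IsUniserialRing (A : Type u) [CommRing A] : Prop := IsUniserial A A

/-- A commutative ring is arithmetic if its localization at every maximal ideal is a valuation
ring. -/
def IsArithmeticRing (R : Type u) [CommRing R] : Prop :=
  ∀ (P : Ideal R) [P.IsMaximal], IsUniserialRing (Localization.AtPrime P)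

section ExactSequences

variable {R : Type u} [CommRing R] {N M L : Type u}
  [AddCommGroup N] [Module R N] [AddCommGroup M] [Module R M] [AddCommGroup L] [Module R L]

/-- `0 → N → M → L → 0` is exact. -/
def IsShortExact (f : N →ₗ[R] M) (g : M →ₗ[R] L) : Prop :=
  Function.Injective f ∧ Function.Exact f g ∧ Function.Surjective g

/-- A short exact sequence is pure-exact if it stays exact after tensoring with any module. -/
def IsPureExact (f : N →ₗ[R] M) (g : M →ₗ[R] L) : Prop :=
  IsShortExact f g ∧
    ∀ (X : Type u) [AddCommGroup X] [Module R X], IsShortExact (f.lTensor X) (g.lTensor X)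

/-- `F` is an RD-submodule (relatively divisible) of `M` if `rM ∩ F = rF` for every `r`. -/
def IsRDSubmodule (F : Submodule R M) : Prop :=
  ∀ r : R, r • (⊤ : Submodule R M) ⊓ F = r • F

/-- A short exact sequence is RD-exact if its left term is an RD-submodule of the middle term. -/
def IsRDExact (f : N →ₗ[R] M) (g : M →ₗ[R] L) : Prop :=
  IsShortExact f g ∧ IsRDSubmodule (LinearMap.range f)

end ExactSequences

section Injectivity

variable (R : Type u) [CommRing R] (F : Type u) [AddCommGroup F] [Module R F]

/-- `F` is pure-injective if `Hom(-, F)` sends pure-exact sequences to short exact sequences. -/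
def IsPureInjective : Prop :=
  ∀ (N M L : Type u) [AddCommGroup N] [Module R N] [AddCommGroup M] [Module R M]
    [AddCommGroup L] [Module R L] (f : N →ₗ[R] M) (g : M →ₗ[R] L),
    IsPureExact f g → IsShortExact (g.lcomp R F) (f.lcomp R F)

/-- `F` is RD-injective if `Hom(-, F)` sends RD-exact sequences to short exact sequences. -/
def IsRDInjective : Prop :=
  ∀ (N M L : Type u) [AddCommGroup N] [Module R N] [AddCommGroup M] [Module R M]
    [AddCommGroup L] [Module R L] (f : N →ₗ[R] M) (g : M →ₗ[R] L),
    IsRDExact f g → IsShortExact (g.lcomp R F) (f.lcomp R F)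

end Injectivity

section Hull

variable {R : Type u} [CommRing R] {M E : Type u}
  [AddCommGroup M] [Module R M] [AddCommGroup E] [Module R E]

/-- `i : M → E` is an injective hull of `M`: an essential embedding into an injective module. -/
def IsInjectiveHull (i : M →ₗ[R] E) : Prop :=
  Function.Injective i ∧ Module.Injective R E ∧
    ∀ K : Submodule R E, K ⊓ LinearMap.range i = ⊥ → K = ⊥

/-- The submodule `{x ∈ E | a x = 0 and b x = 0}`. -/
def commonAnnihilated (E : Type u) [AddCommGroup E] [Module R E] (a b : R) : Submodule R E :=
  Submodule.torsionBy R E a ⊓ Submodule.torsionBy R E b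

end Hull

/-!
For `E` injective, `Hom(X, E)` is pure-injective by the tensor-hom adjunction, and the submodule
`S` of `E` annihilated by `a` and `b` is `Hom(R / (a, b), E)`.

Since `R` is not arithmetic, some maximal ideal `P` and some `a`, `b` generate incomparable ideals
of `R_P`. Let `L = R² / R (a, b)`, let `M` be the direct sum of the modules `R / r R` over all
homomorphisms `R / r R → L`, and let `N` be the kernel of the RD-exact surjection `M → L`. Lift the
two generators of `L` to `g₁, g₂ ∈ M`; then `a g₁ + b g₂ ∈ N`. If `E` contains `R / P` and `S` were
RD-injective, homomorphisms `N → E` vanishing on `(a, b) N` would extend to homomorphisms `M → E`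
vanishing on `(a, b) M`. This forces `u (a g₁ + b g₂) = a n₁ + b n₂` with `u ∉ P` and `n₁, n₂ ∈ N`,
so `(u g₁ - n₁, u g₂ - n₂)` is a solution of `a m₁ + b m₂ = 0` in `M`. But for every such solution,
incomparability of `a` and `b` puts the first coordinate of the image of `m₁` in `L` into `P`,
whereas the image of `u g₁ - n₁` is `(u, 0)`.
-/

section InjectiveHull

theorem exists_le_maximal_disjoint {α : Type*} [CompleteLattice α] [IsCompactlyGenerated α]
    {a b : α} (h : Disjoint a b) : ∃ c, b ≤ c ∧ Maximal (Disjoint a) c :=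
  zorn_le_nonempty₀ {c | Disjoint a c}
    (fun S hS hchain _ _ => ⟨sSup S, hchain.directedOn.disjoint_sSup_right.2 fun _ hc => hS hc,
      fun _ => le_sSup⟩) b h

theorem eq_bot_of_disjoint_of_maximal_disjoint {α : Type*} [Lattice α] [OrderBot α]
    [IsModularLattice α] {w c e k : α} (hc : Maximal (Disjoint w) c) (hce : Disjoint c e)
    (hwe : w ≤ e) (hke : k ≤ e) (hwk : Disjoint w k) : k = ⊥ := by
  have hwkc : Disjoint w (k ⊔ c) :=
    hwk.disjoint_sup_right_of_disjoint_sup_left (hce.symm.mono_left (sup_le hwe hke))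
  have hkc : k ≤ c := le_sup_left.trans (hc.le_of_ge hwkc le_sup_right)
  exact le_bot_iff.1 (hce hkc hke)

section Ring

universe v

variable {R : Type u} [Ring R] {J : Type v} [AddCommGroup J] [Module R J]

theorem module_injective_of_retract [hJ : Module.Injective R J] {E : Type v} [AddCommGroup E]
    [Module R E] (j : E →ₗ[R] J) (p : J →ₗ[R] E) (hpj : p ∘ₗ j = LinearMap.id) :
    Module.Injective R E where
  out X Y _ _ _ _ f hf g := by
    obtain ⟨h, hh⟩ := hJ.out f hf (j ∘ₗ g)
    exact ⟨p ∘ₗ h, fun x => by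
      rw [LinearMap.comp_apply, hh]
      exact LinearMap.congr_fun hpj (g x)⟩

theorem exists_isProj_of_maximal_disjoint [hJ : Module.Injective R J] {W C E : Submodule R J}
    (hC : Maximal (Disjoint W) C) (hE : Maximal (Disjoint C) E) (hWE : W ≤ E) :
    ∃ π : J →ₗ[R] J, LinearMap.IsProj E π := by
  have hinj : Function.Injective (C.mkQ ∘ₗ E.subtype) := by
    rw [← LinearMap.ker_eq_bot, LinearMap.ker_comp, Submodule.ker_mkQ,
      ← Submodule.disjoint_iff_comap_eq_bot]
    exact hE.prop.symm
  obtain ⟨h, hh⟩ := hJ.out _ hinj E.subtype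
  let π : J →ₗ[R] J := h ∘ₗ C.mkQ
  have hπE : ∀ e ∈ E, π e = e := fun e he => hh ⟨e, he⟩
  have hπC : ∀ c ∈ C, π c = 0 := fun c hc => by
    rw [LinearMap.comp_apply, Submodule.mkQ_apply, (Submodule.Quotient.mk_eq_zero C).2 hc, map_zero]
  have hcomap : C.comap π ≤ C := by
    refine hC.le_of_ge (Submodule.disjoint_def.2 fun w hw hπw => ?_) fun c hc => ?_
    · rw [Submodule.mem_comap, hπE w (hWE hw)] at hπw
      exact Submodule.disjoint_def.1 hC.prop w hw hπw
    · rw [Submodule.mem_comap, hπC c hc]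
      exact C.zero_mem
  have hdisj : Disjoint C (LinearMap.range π) := by
    rw [Submodule.disjoint_def]
    rintro _ hx ⟨x, rfl⟩
    exact hπC x (hcomap hx)
  have hrange : LinearMap.range π ≤ E := hE.le_of_ge hdisj fun e he => ⟨e, hπE e he⟩
  exact ⟨π, fun x => hrange ⟨x, rfl⟩, hπE⟩

end Ring

variable {R : Type u} [CommRing R]

theorem exists_injective_embedding (M : Type u) [AddCommGroup M] [Module R M] :
    ∃ (J : Type u) (_ : AddCommGroup J) (_ : Module R J) (i : M →ₗ[R] J),
      Function.Injective i ∧ Module.Injective R J := by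
  obtain ⟨J, hJ, f, hf⟩ := CategoryTheory.EnoughInjectives.presentation (ModuleCat.of R M)
  exact ⟨J, inferInstance, inferInstance, f.hom, (ModuleCat.mono_iff_injective f).1 hf,
    (Module.injective_iff_injective_object R J).2 hJ⟩

theorem exists_isInjectiveHull (M : Type u) [AddCommGroup M] [Module R M] :
    ∃ (E : Type u) (_ : AddCommGroup E) (_ : Module R E) (i : M →ₗ[R] E), IsInjectiveHull i := by
  obtain ⟨J, _, _, i, hi, _⟩ := exists_injective_embedding (R := R) M
  obtain ⟨C, -, hC⟩ := exists_le_maximal_disjoint (disjoint_bot_right (a := LinearMap.range i))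
  obtain ⟨E, hiE, hE⟩ := exists_le_maximal_disjoint hC.prop.symm
  obtain ⟨π, hπ⟩ := exists_isProj_of_maximal_disjoint hC hE hiE
  have hmem : ∀ m, i m ∈ E := fun m => hiE ⟨m, rfl⟩
  refine ⟨E, inferInstance, inferInstance, i.codRestrict E hmem,
    (LinearMap.injective_codRestrict_iff hmem).2 hi,
    module_injective_of_retract E.subtype hπ.codRestrict
      (LinearMap.ext hπ.codRestrict_apply_cod), fun K hK => ?_⟩
  have hKi : Disjoint (LinearMap.range i) (K.map E.subtype) := by
    rw [disjoint_iff, inf_comm, Submodule.map_inf_eq_map_inf_comap,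
      ← LinearMap.range_codRestrict E i hmem, hK, Submodule.map_bot]
  rw [← (Submodule.map_injective_of_injective E.injective_subtype).eq_iff, Submodule.map_bot]
  exact eq_bot_of_disjoint_of_maximal_disjoint hC hE.prop hiE (Submodule.map_subtype_le E K) hKi

end InjectiveHull

section PureInjective

variable {R : Type u} [CommRing R]

theorem IsShortExact.lcomp {N M L F : Type u} [AddCommGroup N] [Module R N]
    [AddCommGroup M] [Module R M] [AddCommGroup L] [Module R L] [AddCommGroup F] [Module R F]
    {f : N →ₗ[R] M} {g : M →ₗ[R] L} (h : IsShortExact f g)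
    (hf : Function.Surjective (f.lcomp R F)) : IsShortExact (g.lcomp R F) (f.lcomp R F) :=
  ⟨LinearMap.lcomp_injective_of_surjective g h.2.2,
    LinearMap.exact_lcomp_of_exact_of_surjective F h.2.1 h.2.2, hf⟩

theorem IsPureInjective.of_equiv {F F' : Type u} [AddCommGroup F] [Module R F]
    [AddCommGroup F'] [Module R F'] (hF : IsPureInjective R F) (e : F ≃ₗ[R] F') :
    IsPureInjective R F' := by
  intro N M L _ _ _ _ _ _ f g hfg
  refine hfg.1.lcomp fun φ => ?_
  obtain ⟨ψ, hψ⟩ := (hF N M L f g hfg).2.2 (e.symm ∘ₗ φ)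
  refine ⟨e ∘ₗ ψ, LinearMap.ext fun n => ?_⟩
  exact (e.eq_symm_apply).1 (LinearMap.congr_fun hψ n)

/-- By adjunction, extending `N → Hom(X, E)` to `M` amounts to extending `X ⊗ N → E` to `X ⊗ M`. -/
theorem isPureInjective_linearMap (X E : Type u) [AddCommGroup X] [Module R X] [AddCommGroup E]
    [Module R E] [hE : Module.Injective R E] : IsPureInjective R (X →ₗ[R] E) := by
  intro N M L _ _ _ _ _ _ f g hfg
  refine hfg.1.lcomp fun φ => ?_
  obtain ⟨ψ, hψ⟩ := hE.out (f.lTensor X) (hfg.2 X).1 (TensorProduct.lift φ.flip)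
  exact ⟨(TensorProduct.curry ψ).flip, LinearMap.ext₂ fun n x => hψ (x ⊗ₜ n)⟩

/-- Evaluation at `1` identifies `Hom(R/I, E)` with the elements of `E` annihilated by `I`. -/
def quotientHomEquivTorsionBySet (I : Ideal R) (E : Type*) [AddCommGroup E] [Module R E] :
    ((R ⧸ I) →ₗ[R] E) ≃ₗ[R] Submodule.torsionBySet R E (I : Set R) where
  toFun φ := ⟨φ 1, (Submodule.mem_torsionBySet_iff _ _).2 fun r => by
    rw [← map_smul, Module.mem_annihilator.1 (I.annihilator_quotient.ge r.2), map_zero]⟩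
  map_add' _ _ := rfl
  map_smul' _ _ := rfl
  invFun x := Submodule.liftQ I (LinearMap.toSpanSingleton R E x) fun r hr =>
    (Submodule.mem_torsionBySet_iff _ _).1 x.2 ⟨r, hr⟩
  left_inv φ := Submodule.linearMap_qext _ <| LinearMap.ext_ring (one_smul R (φ 1))
  right_inv x := Subtype.ext (one_smul R (x : E))

theorem isPureInjective_torsionBySet (I : Ideal R) (E : Type u) [AddCommGroup E] [Module R E]
    [Module.Injective R E] : IsPureInjective R (Submodule.torsionBySet R E (I : Set R)) :=
  (isPureInjective_linearMap (R ⧸ I) E).of_equiv (quotientHomEquivTorsionBySet I E)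

theorem commonAnnihilated_eq_torsionBySet (E : Type u) [AddCommGroup E] [Module R E] (a b : R) :
    commonAnnihilated E a b = Submodule.torsionBySet R E (Ideal.span {a, b} : Set R) := by
  rw [← Submodule.torsionBySet_eq_torsionBySet_span]
  ext x
  simp [commonAnnihilated, Submodule.mem_torsionBySet_iff]

end PureInjective

section RDInjective

variable {R : Type u} [CommRing R]

theorem exists_linearMap_apply_eq {X E : Type u} [AddCommGroup X] [Module R X] [AddCommGroup E]
    [Module R E] [hE : Module.Injective R E] {x : X} {y : E}
    (h : Ideal.torsionOf R X x ≤ Ideal.torsionOf R E y) : ∃ φ : X →ₗ[R] E, φ x = y := by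
  let toX : (R ⧸ Ideal.torsionOf R X x) →ₗ[R] X :=
    Submodule.liftQ _ (LinearMap.toSpanSingleton R X x) le_rfl
  let toE : (R ⧸ Ideal.torsionOf R X x) →ₗ[R] E :=
    Submodule.liftQ _ (LinearMap.toSpanSingleton R E y) h
  have htoX : Function.Injective toX :=
    LinearMap.ker_eq_bot.1 (Submodule.ker_liftQ_eq_bot _ _ _ le_rfl)
  obtain ⟨φ, hφ⟩ := hE.out toX htoX toE
  have htoX_one : toX (Submodule.Quotient.mk 1) = x := one_smul R x
  have htoE_one : toE (Submodule.Quotient.mk 1) = y := one_smul R y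
  exact ⟨φ, by rw [← htoX_one, hφ, htoE_one]⟩

theorem range_le_torsionBySet_iff {M E : Type*} [AddCommGroup M] [Module R M] [AddCommGroup E]
    [Module R E] {I : Ideal R} {φ : M →ₗ[R] E} :
    LinearMap.range φ ≤ Submodule.torsionBySet R E (I : Set R) ↔
      I • (⊤ : Submodule R M) ≤ LinearMap.ker φ := by
  rw [Submodule.smul_le]
  constructor
  · intro h r hr m _
    rw [LinearMap.mem_ker, map_smul]
    exact (Submodule.mem_torsionBySet_iff _ _).1 (h ⟨m, rfl⟩) ⟨r, hr⟩
  · rintro h _ ⟨m, rfl⟩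
    rw [Submodule.mem_torsionBySet_iff]
    exact fun r => (map_smul φ (r : R) m).symm.trans (h r r.2 m Submodule.mem_top)

theorem IsRDInjective.exists_smul_mem_smul_top {I P : Ideal R} (hP : P ≠ ⊤) {E : Type u}
    [AddCommGroup E] [Module R E] [Module.Injective R E] {i : (R ⧸ P) →ₗ[R] E}
    (hi : Function.Injective i) (hRD : IsRDInjective R (Submodule.torsionBySet R E (I : Set R)))
    {N M L : Type u} [AddCommGroup N] [Module R N] [AddCommGroup M] [Module R M]
    [AddCommGroup L] [Module R L] {f : N →ₗ[R] M} {g : M →ₗ[R] L} (hfg : IsRDExact f g) {n : N}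
    (hn : f n ∈ I • (⊤ : Submodule R M)) : ∃ u ∉ P, u • n ∈ I • (⊤ : Submodule R N) := by
  by_contra! hnP
  let IN : Submodule R N := I • ⊤
  have htorsion : Ideal.torsionOf R _ (IN.mkQ n) ≤ Ideal.torsionOf R E (i 1) := fun u hu => by
    rw [Ideal.mem_torsionOf_iff, ← map_smul, Submodule.mkQ_apply,
      Submodule.Quotient.mk_eq_zero] at hu
    have huP : u ∈ P := by_contra fun huP => hnP u huP hu
    rw [Ideal.mem_torsionOf_iff, ← map_smul,
      Module.mem_annihilator.1 (P.annihilator_quotient.ge huP), map_zero]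
  obtain ⟨φ, hφ⟩ := exists_linearMap_apply_eq htorsion
  have hφI : LinearMap.range (φ ∘ₗ IN.mkQ) ≤ Submodule.torsionBySet R E (I : Set R) := by
    rw [range_le_torsionBySet_iff]
    exact IN.ker_mkQ.ge.trans (LinearMap.ker_le_ker_comp _ _)
  obtain ⟨ψ, hψ⟩ := (hRD N M L f g hfg).2.2
    ((φ ∘ₗ IN.mkQ).codRestrict _ fun m => hφI ⟨m, rfl⟩)
  have hψn : (ψ (f n) : E) = i 1 :=
    (congrArg Subtype.val (LinearMap.congr_fun hψ n)).trans hφ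
  have hψI : I • (⊤ : Submodule R M) ≤ LinearMap.ker (Submodule.subtype _ ∘ₗ ψ) := by
    rw [← range_le_torsionBySet_iff]
    rintro _ ⟨m, rfl⟩
    exact (ψ m).2
  have hi1 : i 1 = i 0 := by rw [← hψn, map_zero]; exact hψI hn
  exact hP ((Ideal.eq_top_iff_one P).2 (Ideal.Quotient.eq_zero_iff_mem.1 (hi hi1)))

theorem IsShortExact.isRDExact {N M L : Type u} [AddCommGroup N] [Module R N] [AddCommGroup M]
    [Module R M] [AddCommGroup L] [Module R L] {f : N →ₗ[R] M} {g : M →ₗ[R] L}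
    (hfg : IsShortExact f g)
    (hlift : ∀ (r : R) (l : L), r • l = 0 → ∃ m, r • m = 0 ∧ g m = l) : IsRDExact f g := by
  refine ⟨hfg, fun r => le_antisymm ?_ (le_inf (Submodule.map_mono le_top) ?_)⟩
  · rintro _ ⟨⟨m, -, rfl⟩, hm⟩
    have hgm : r • g m = 0 := by rw [← map_smul]; exact (hfg.2.1 _).2 hm
    obtain ⟨m', hm', hgm'⟩ := hlift r _ hgm
    refine ⟨m - m', (hfg.2.1 _).1 (by rw [map_sub, hgm', sub_self]), ?_⟩
    change r • (m - m') = r • m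
    rw [smul_sub, hm', sub_zero]
  · rintro _ ⟨m, hm, rfl⟩
    exact Submodule.smul_mem _ r hm

end RDInjective

section RDCover

variable (R : Type u) [CommRing R] (L : Type u) [AddCommGroup L] [Module R L]

/-- The pairs `(r, l)` with `r l = 0`, which index the homomorphisms `R / r R → L`. -/
abbrev TorsionPair : Type u := {i : R × L // i.1 • i.2 = 0}

variable {R L} in
/-- The homomorphism `R / r R → L` determined by a pair `(r, l)` with `r l = 0`. -/
def TorsionPair.cyclicMap (i : TorsionPair R L) : (R ⧸ (R ∙ i.1.1)) →ₗ[R] L :=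
  Submodule.liftQSpanSingleton i.1.1 (LinearMap.toSpanSingleton R L i.1.2) i.2

/-- The direct sum of copies of the modules `R / r R`, one for each homomorphism `R / r R → L`: an
RD-projective module with a canonical RD-exact surjection onto `L`. -/
abbrev RDCover : Type u := Π₀ i : TorsionPair R L, R ⧸ (R ∙ i.1.1)

namespace RDCover

/-- The canonical surjection of `RDCover R L` onto `L`. -/
noncomputable def proj : RDCover R L →ₗ[R] L := by
  classical exact DFinsupp.lsum ℕ TorsionPair.cyclicMap

variable {R L}

theorem map_proj_eq_zero {X : Type*} [AddCommGroup X] [Module R X] (ε : L →ₗ[R] X)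
    {m : RDCover R L} (h : ∀ i : TorsionPair R L, ε (i.cyclicMap (m i)) = 0) :
    ε (proj R L m) = 0 := by
  classical
  rw [proj, DFinsupp.lsum_apply_apply, DFinsupp.sumAddHom_apply, DFinsupp.sum, map_sum]
  exact Finset.sum_eq_zero fun i _ => h i

theorem exists_smul_eq_zero_and_proj_eq {r : R} {l : L} (h : r • l = 0) :
    ∃ m, r • m = 0 ∧ proj R L m = l := by
  classical
  let i : TorsionPair R L := ⟨(r, l), h⟩
  refine ⟨DFinsupp.single i (Submodule.Quotient.mk 1), ?_, ?_⟩
  · have hr : r ∈ Module.annihilator R (R ⧸ (R ∙ r)) :=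
      Ideal.annihilator_quotient.ge (Submodule.mem_span_singleton_self r)
    rw [← DFinsupp.single_smul, Module.mem_annihilator.1 hr, DFinsupp.single_zero]
  · rw [proj, DFinsupp.lsum_single]
    exact one_smul R l

variable (R L)

theorem proj_surjective : Function.Surjective (proj R L) := fun l =>
  (exists_smul_eq_zero_and_proj_eq (zero_smul R l)).imp fun _ => And.right

theorem isRDExact_proj :
    IsRDExact (N := LinearMap.ker (proj R L)) (LinearMap.ker (proj R L)).subtype (proj R L) :=
  IsShortExact.isRDExact ⟨Submodule.injective_subtype _, LinearMap.exact_subtype_ker_map _,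
    proj_surjective R L⟩ fun _ _ => exists_smul_eq_zero_and_proj_eq

end RDCover

end RDCover

section LocallyIncomparable

variable {R : Type u} [CommRing R]

/-- The ideals generated by `a` and `b` are incomparable in the localization of `R` at `P`,
expressed without fractions: `b` divides no multiple of `a` by an element outside `P`, and vice
versa. -/
structure LocallyIncomparable (P : Ideal R) (a b : R) : Prop where
  mem_of_dvd_mul_left : ∀ u, b ∣ u * a → u ∈ P
  mem_of_dvd_mul_right : ∀ u, a ∣ u * b → u ∈ P

theorem exists_locallyIncomparable {P : Ideal R} [P.IsPrime]
    (h : ¬ IsUniserialRing (Localization.AtPrime P)) : ∃ a b, LocallyIncomparable P a b := by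
  have mem_of_dvd_mul {K : Ideal (Localization.AtPrime P)} {a b : R} (ha : a ∉ K.under R)
      (hb : b ∈ K.under R) (u : R) (hu : b ∣ u * a) : u ∈ P := by
    by_contra huP
    have hua : algebraMap R _ u * algebraMap R _ a ∈ K := by
      rw [← map_mul]
      exact (K.under R).mem_of_dvd hu hb
    exact ha ((K.unit_mul_mem_iff_mem
      (IsLocalization.map_units (Localization.AtPrime P) (⟨u, huP⟩ : P.primeCompl))).1 hua)
  simp only [IsUniserialRing, IsUniserial, not_forall, not_or,
    ← (IsLocalization.orderEmbedding P.primeCompl (Localization.AtPrime P)).le_iff_le,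
    SetLike.not_le_iff_exists] at h
  obtain ⟨K, K', ⟨a, haK, haK'⟩, b, hbK', hbK⟩ := h
  exact ⟨a, b, mem_of_dvd_mul haK' hbK', mem_of_dvd_mul hbK haK⟩

/-- The module with two generators and the single relation `(a, b)`. -/
abbrev PairQuotient (a b : R) : Type u := (R × R) ⧸ (R ∙ (a, b))

/-- The first coordinate modulo `P`, well defined on the quotient by `(a, b)` because `a ∈ P`. -/
def PairQuotient.fstMod {P : Ideal R} {a b : R} (ha : a ∈ P) : PairQuotient a b →ₗ[R] R ⧸ P :=
  Submodule.liftQSpanSingleton (a, b) (P.mkQ ∘ₗ LinearMap.fst R R R)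
    ((Submodule.Quotient.mk_eq_zero P).2 ha)

theorem mem_span_pair_smul_top_iff {N : Type*} [AddCommGroup N] [Module R N] {a b : R} {n : N} :
    n ∈ Ideal.span {a, b} • (⊤ : Submodule R N) ↔ ∃ n₁ n₂, a • n₁ + b • n₂ = n := by
  simp only [Ideal.span_insert, Submodule.sup_smul, Submodule.ideal_span_singleton_smul,
    Submodule.mem_sup, Submodule.mem_smul_pointwise_iff_exists, Submodule.mem_top, true_and,
    exists_exists_eq_and]

namespace LocallyIncomparable

variable {P : Ideal R} {a b : R}

theorem symm (h : LocallyIncomparable P a b) : LocallyIncomparable P b a :=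
  ⟨h.mem_of_dvd_mul_right, h.mem_of_dvd_mul_left⟩

theorem left_mem (h : LocallyIncomparable P a b) : a ∈ P :=
  h.mem_of_dvd_mul_right a (dvd_mul_right a b)

theorem right_mem (h : LocallyIncomparable P a b) : b ∈ P := h.symm.left_mem

theorem mul_mem [hP : P.IsPrime] (h : LocallyIncomparable P a b) {r x y s c₁ c₂ d : R}
    (hx : r * x = s * a) (hy : r * y = s * b) (hc : a * c₁ + b * c₂ = r * d) : c₁ * x ∈ P := by
  have hsub : c₁ * x - s * d ∈ P :=
    h.mem_of_dvd_mul_left _ ⟨-(x * c₂), by linear_combination x * hc + d * hx⟩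
  have hxs : x * s ∈ P := h.mem_of_dvd_mul_right _ ⟨y * s, by linear_combination y * hx - x * hy⟩
  rcases hP.mem_or_mem hxs with hxP | hsP
  · exact P.mul_mem_left c₁ hxP
  · exact (P.sub_mem_iff_left (P.mul_mem_right d hsP)).1 hsub

theorem fstMod_cyclicMap_eq_zero [P.IsPrime] (h : LocallyIncomparable P a b)
    (i : TorsionPair R (PairQuotient a b)) {m₁ m₂ : R ⧸ (R ∙ i.1.1)}
    (hm : a • m₁ + b • m₂ = 0) : PairQuotient.fstMod h.left_mem (i.cyclicMap m₁) = 0 := by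
  obtain ⟨⟨r, l⟩, hl⟩ := i
  obtain ⟨⟨x, y⟩, rfl⟩ := Submodule.Quotient.mk_surjective _ l
  obtain ⟨c₁, rfl⟩ := Submodule.Quotient.mk_surjective _ m₁
  obtain ⟨c₂, rfl⟩ := Submodule.Quotient.mk_surjective _ m₂
  obtain ⟨s, hs⟩ := Submodule.mem_span_singleton.1 ((Submodule.Quotient.mk_eq_zero _).1 hl)
  obtain ⟨d, hd⟩ := Submodule.mem_span_singleton.1 ((Submodule.Quotient.mk_eq_zero _).1 hm)
  exact (Submodule.Quotient.mk_eq_zero P).2 <| h.mul_mem (congrArg Prod.fst hs).symm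
    (congrArg Prod.snd hs).symm (hd.symm.trans (mul_comm d r))

theorem fstMod_proj_eq_zero [P.IsPrime] (h : LocallyIncomparable P a b)
    {m₁ m₂ : RDCover R (PairQuotient a b)} (hm : a • m₁ + b • m₂ = 0) :
    PairQuotient.fstMod h.left_mem (RDCover.proj R _ m₁) = 0 :=
  RDCover.map_proj_eq_zero _ fun i =>
    h.fstMod_cyclicMap_eq_zero i (m₂ := m₂ i) (DFunLike.congr_fun hm i)

theorem not_isRDInjective [hP : P.IsPrime] (h : LocallyIncomparable P a b) {E : Type u}
    [AddCommGroup E] [Module R E] [Module.Injective R E] {i : (R ⧸ P) →ₗ[R] E}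
    (hi : Function.Injective i) :
    ¬ IsRDInjective R (Submodule.torsionBySet R E (Ideal.span {a, b} : Set R)) := by
  intro hRD
  obtain ⟨g₁, hg₁⟩ := RDCover.proj_surjective R (PairQuotient a b) (Submodule.Quotient.mk (1, 0))
  obtain ⟨g₂, hg₂⟩ := RDCover.proj_surjective R (PairQuotient a b) (Submodule.Quotient.mk (0, 1))
  have hrel : a • g₁ + b • g₂ ∈ LinearMap.ker (RDCover.proj R (PairQuotient a b)) := by
    rw [LinearMap.mem_ker, map_add, map_smul, map_smul, hg₁, hg₂]
    refine (Submodule.Quotient.mk_eq_zero _).2 (Submodule.mem_span_singleton.2 ⟨1, ?_⟩)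
    simp
  obtain ⟨u, huP, hu⟩ := hRD.exists_smul_mem_smul_top hP.ne_top hi
    (RDCover.isRDExact_proj R _) (n := ⟨_, hrel⟩) (mem_span_pair_smul_top_iff.2 ⟨g₁, g₂, rfl⟩)
  obtain ⟨n₁, n₂, hn⟩ := mem_span_pair_smul_top_iff.1 hu
  have hm : a • (u • g₁ - n₁) + b • (u • g₂ - n₂) = 0 :=
    calc
      _ = u • (a • g₁ + b • g₂) - (a • (n₁ : RDCover R (PairQuotient a b)) + b • n₂) := by module
      _ = 0 := sub_eq_zero.2 (congrArg Subtype.val hn).symm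
  have hfst := h.fstMod_proj_eq_zero hm
  rw [map_sub, map_smul, LinearMap.mem_ker.1 n₁.2, sub_zero, hg₁] at hfst
  have huP' : u * 1 ∈ P := (Submodule.Quotient.mk_eq_zero P).1 hfst
  exact huP (mul_one u ▸ huP')

end LocallyIncomparable

end LocallyIncomparable

theorem mainTheorem4 (R : Type u) [CommRing R] (hR : ¬ IsArithmeticRing R) :
    (∃ (F : Type u) (_ : AddCommGroup F) (_ : Module R F),
      IsPureInjective R F ∧ ¬ IsRDInjective R F) ∧
    ∃ P : Ideal R, P.IsMaximal ∧ ∃ a ∈ P, ∃ b ∈ P,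
      (∃ (E : Type u) (_ : AddCommGroup E) (_ : Module R E) (i : (R ⧸ P) →ₗ[R] E),
        IsInjectiveHull i) ∧
      ∀ (E : Type u) [AddCommGroup E] [Module R E] (i : (R ⧸ P) →ₗ[R] E), IsInjectiveHull i →
        IsPureInjective R (commonAnnihilated E a b) ∧
        ¬ IsRDInjective R (commonAnnihilated E a b) := by
  simp only [IsArithmeticRing, not_forall] at hR
  obtain ⟨P, hP, huniserial⟩ := hR
  obtain ⟨a, b, h⟩ := exists_locallyIncomparable huniserial
  have hull {E : Type u} [AddCommGroup E] [Module R E] {i : (R ⧸ P) →ₗ[R] E}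
      (hi : IsInjectiveHull i) : IsPureInjective R (commonAnnihilated E a b) ∧
        ¬ IsRDInjective R (commonAnnihilated E a b) := by
    have := hi.2.1
    rw [commonAnnihilated_eq_torsionBySet]
    exact ⟨isPureInjective_torsionBySet _ E, h.not_isRDInjective hi.1⟩
  obtain ⟨E, _, _, i, hi⟩ := exists_isInjectiveHull (R := R) (R ⧸ P)
  exact ⟨⟨commonAnnihilated E a b, inferInstance, inferInstance, hull hi⟩,
    P, hP, a, h.left_mem, b, h.right_mem, ⟨E, _, _, i, hi⟩, fun _ _ _ _ hi' => hull hi'⟩
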